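/- Consider a server in discrete time with slots $1,2,\dots$. In each slot a request arrives, independently of the other slots, with probability $\lambda\in(0,1)$. In each slot the server may update its data. The age of information is $1$ in slot $1$ before the decision of that slot; an update makes it $0$ at once, and otherwise it grows by $1$ per slot. A request answered at age $\Delta$ costs $f(\Delta)$, where $f:[0,\infty)\to[0,\infty)$ is non-decreasing and $f(0)=0$; each update costs $p\ge 0$. The average cost $\bar C^{\pi}$ of a policy $\pi$ is $\lim_{N\to\infty}\frac1N\mathbb E[C^\pi(N)]$, where $C^\pi(N)$ is the sum of the staleness costs of the first $N$ requests and of the costs of the updates up to the $N$-th request (if the limit does not exist, take the lower limit). A policy is online if it is possibly randomized and its decision in slot $t$ uses no information on the arrivals after slot $t$. For an integer $\tau\ge1$, $\pi(\tau)$ is the policy that updates exactly when a request arrives and the age is at least $\tau$. Let $S$ be a real function on $(0,\infty)$ that extends the sums, i.e. $S(n)=\sum_{t=1}^{n-1}f(t)$ for all integers $n\ge1$, and is such that for every integer $n\ge1$ and every $\tau>0$ outside the interval $(n,n+1)$ one has $S(\tau)\ge S(n)+f(n)(\tau-n)$ (every extension that is convex on $(0,\infty)$ has this property), and put $$F(\tau)=\frac{\lambda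 S(\tau)+p}{\lambda(\tau-1)+1},\qquad \tau>0 .$$ Then every $\pi(n)$ with an integer $n\ge1$ is online, its average cost exists as a limit, and $\bar C^{\pi(n)}=F(n)$. If $\tau'>0$ minimizes $F$ over the positive reals, and $\tau^*$ minimizes $\bar C^{\pi(\tau)}$ over the positive integers $\tau\in\{\lfloor\tau'\rfloor,\lceil\tau'\rceil\}$, then $\pi(\tau^*)$ has the smallest average cost among all threshold policies $\pi(n)$, $n\ge1$, and also among all online policies. Moreover, such an extension $S$ exists, and it can be chosen so that a minimizer $\tau'$ of $F$ exists whenever $f(\Delta)\ge p$ for some $\Delta$. -/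

import Mathlib

open MeasureTheory ProbabilityTheory Filter Topology
open scoped NNReal ENNReal

/-! Time-slots are indexed by `t : ℕ`, where `t` stands for the `(t+1)`-st slot. A path
`x : ℕ → Bool` records in which slots a request arrives, and a path `u : ℕ → Bool` records in
which slots the server updates. -/

/-- Age of information in slot `t` before the decision of slot `t` takes effect.
It is `1` in the first slot and grows by `1` from its value at the end of the previous slot. -/
def aoiBefore (u : ℕ → Bool) : ℕ → ℕ
  | 0 => 1
  | t + 1 => (if u t = true then 0 else aoiBefore u t) + 1

/-- Age of information `Δ(t)` with which a request of slot `t` is answered: it is `0` if the server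
updates in slot `t`. -/
def aoi (u : ℕ → Bool) (t : ℕ) : ℕ :=
  if u t = true then 0 else aoiBefore u t

/-- The slot of the `(j+1)`-st request. (Under Bernoulli arrivals there are almost surely
infinitely many requests.) -/
noncomputable def requestTime (x : ℕ → Bool) (j : ℕ) : ℕ :=
  Nat.nth (fun t => x t = true) j

/-- The number of updates up to and including the slot of the `N`-th request (`N ≥ 1`). -/
noncomputable def numUpdates (x u : ℕ → Bool) (N : ℕ) : ℕ :=
  Nat.count (fun t => u t = true) (requestTime x (N - 1) + 1)

/-- The total cost of serving the first `N` requests (`N ≥ 1`): staleness costs plus update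
costs. -/
noncomputable def totalCost (f : ℝ≥0 → ℝ≥0) (p : ℝ≥0) (x u : ℕ → Bool) (N : ℕ) : ℝ≥0 :=
  (∑ j ∈ Finset.range N, f (aoi u (requestTime x j))) + p * (numUpdates x u N)

/-- The age (before the decision) under the threshold rule with threshold `τ`. -/
def thresholdAge (τ : ℕ) (x : ℕ → Bool) : ℕ → ℕ
  | 0 => 1
  | t + 1 => (if x t = true ∧ τ ≤ thresholdAge τ x t then 0 else thresholdAge τ x t) + 1

/-- The updates of the threshold-based policy with threshold `τ`: update exactly when a request
arrives and the age is at least `τ`. -/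
def thresholdUpdates (τ : ℕ) (x : ℕ → Bool) (t : ℕ) : Bool :=
  decide (x t = true ∧ τ ≤ thresholdAge τ x t)

/-- `thresholdAge` is the age of information generated by the threshold updates. -/
theorem aoiBefore_thresholdUpdates (τ : ℕ) (x : ℕ → Bool) (t : ℕ) :
    aoiBefore (thresholdUpdates τ x) t = thresholdAge τ x t := by
  induction t with
  | zero => rfl
  | succ t ih => simp [aoiBefore, thresholdAge, thresholdUpdates, ih]

/-- The defining rule of the threshold-based policy. -/
theorem thresholdUpdates_eq_true_iff (τ : ℕ) (x : ℕ → Bool) (t : ℕ) :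
    thresholdUpdates τ x t = true ↔
      x t = true ∧ τ ≤ aoiBefore (thresholdUpdates τ x) t := by
  rw [aoiBefore_thresholdUpdates]
  simp [thresholdUpdates]

section Stochastic

variable {Ω : Type*} [MeasurableSpace Ω]

/-- `X` is a Bernoulli(`lam`) arrival process: independently in every slot, a request arrives with
probability `lam`. -/
structure IsBernoulliArrivals (μ : Measure Ω) (X : ℕ → Ω → Bool) (lam : ℝ) : Prop where
  measurable : ∀ t, Measurable (X t)
  indep : iIndepFun X μ
  prob : ∀ t, μ {ω | X t ω = true} = ENNReal.ofReal lam

/-- The random updates `U` come from a (possibly randomized) online policy: the decision in slot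
`t` is a function of information `ℱ t` that accumulates over time, contains the arrivals up to
slot `t`, and is independent of the arrivals after slot `t`. -/
def IsOnline (μ : Measure Ω) (X U : ℕ → Ω → Bool) : Prop :=
  ∃ ℱ : Filtration ℕ (inferInstance : MeasurableSpace Ω),
    (∀ t, Measurable[ℱ t] (X t)) ∧ (∀ t, Measurable[ℱ t] (U t)) ∧
      ∀ t, Indep (ℱ t) (⨆ s ∈ Set.Ioi t, MeasurableSpace.comap (X s) ⊤) μ

/-- The expected cost per request of serving the first `N` requests. -/
noncomputable def costPerRequest (μ : Measure Ω) (f : ℝ≥0 → ℝ≥0) (p : ℝ≥0) (X U : ℕ → Ω → Bool)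
    (N : ℕ) : ℝ≥0∞ :=
  (∫⁻ ω, (totalCost f p (fun t => X t ω) (fun t => U t ω) N : ℝ≥0∞) ∂μ) / N

/-- The long-term average expected cost per request. It is the limit if the limit exists; for
updates without a limit it is the lower limit, which makes a lower bound on it strongest. -/
noncomputable def averageCost (μ : Measure Ω) (f : ℝ≥0 → ℝ≥0) (p : ℝ≥0) (X U : ℕ → Ω → Bool) :
    ℝ≥0∞ :=
  liminf (costPerRequest μ f p X U) atTop

/-- The random updates of the threshold-based policy `π(τ)`. -/
def thresholdPolicy (X : ℕ → Ω → Bool) (τ : ℕ) : ℕ → Ω → Bool :=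
  fun t ω => thresholdUpdates τ (fun s => X s ω) t

end Stochastic

/-- `S` extends the sums `n ↦ ∑_{t=1}^{n-1} f(t)` from positive integers to positive reals and
keeps their convexity in the following weak sense: for every integer `n ≥ 1`, outside the interval
`(n, n+1)` the graph of `S` is on or above the line through `(n, S n)` and `(n+1, S (n+1))`, whose
slope is `f n`. Every extension that is convex on the positive reals has this property. -/
structure IsSumExtension (f : ℝ≥0 → ℝ≥0) (S : ℝ → ℝ) : Prop where
  eq_sum : ∀ n : ℕ, 1 ≤ n → S n = ∑ t ∈ Finset.Ico 1 n, (f t : ℝ)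
  above_line : ∀ n : ℕ, 1 ≤ n → ∀ τ : ℝ, 0 < τ → (τ ≤ n ∨ (n : ℝ) + 1 ≤ τ) →
    S n + f n * (τ - n) ≤ S τ

/-- The closed-form cost `(λ ∑_{t=1}^{τ-1} f(t) + p) / (λ (τ - 1) + 1)` of a real `τ`, where `S τ`
stands for the sum. -/
noncomputable def closedFormCost (lam : ℝ) (p : ℝ≥0) (S : ℝ → ℝ) (τ : ℝ) : ℝ :=
  (lam * S τ + p) / (lam * (τ - 1) + 1)

/-! The proof is a verification argument for an average-cost optimality equation. Fix n and put g =
F(n). With w = `excessCost` and h = `relativeValue`, under π(n) each slot satisfies: cost, minus g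
if a request arrives, plus the increment of h along the age, equals (arrival − λ) · w(age)
(`increment_thresholdUpdates`). The right side has mean zero, because the age before a slot is
independent of the arrival in it. Summed up to the N-th request, the increments of h telescope to a
bounded term, so the expected cost is gN + O(1). If moreover f ≤ g below n and g ≤ f(n), the
equation becomes an inequality valid for arbitrary updates (`le_increment`), and g bounds the cost
of every online policy from below (`ofReal_le_averageCost`).

What remains is deterministic: the best rounding n of τ' satisfies f(n − 1) ≤ F(n) ≤ f(n)
(`IsSumExtension.crossing`), the left part only for n ≥ 2. Since F(n + 1) is a weighted mean of F(n)
and f(n), comparing F at neighbouring integers amounts to comparing F with f. Where the roundings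
give no such comparison, a line below S shows that a violation would force F(τ') > F(n). -/

/-! ### Ages, and the cost of N requests as a sum over slots. -/

theorem aoiBefore_le (u : ℕ → Bool) (t : ℕ) : aoiBefore u t ≤ t + 1 := by
  induction t with
  | zero => simp [aoiBefore]
  | succ t ih => simp only [aoiBefore]; split_ifs <;> omega

theorem aoi_le (u : ℕ → Bool) (t : ℕ) : aoi u t ≤ t + 1 := by
  have := aoiBefore_le u t
  unfold aoi; split_ifs <;> omega

theorem one_le_aoiBefore (u : ℕ → Bool) (t : ℕ) : 1 ≤ aoiBefore u t := by
  cases t <;> simp [aoiBefore]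

theorem aoiBefore_succ (u : ℕ → Bool) (t : ℕ) : aoiBefore u (t + 1) = aoi u t + 1 := rfl

/-- The cost incurred in slot `t`. -/
noncomputable def slotCost (f : ℝ≥0 → ℝ≥0) (p : ℝ≥0) (x u : ℕ → Bool) (t : ℕ) : ℝ≥0 :=
  (if x t = true then f (aoi u t) else 0) + p * (if u t = true then 1 else 0)

/-- A sum over the first `N` requests as a sum over slots. -/
theorem sum_requestTime {M : Type*} [AddCommMonoid M] (x : ℕ → Bool)
    (hx : {t | x t = true}.Infinite) (N K : ℕ) (hK : ∀ j < N, requestTime x j < K) (φ : ℕ → M) :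
    ∑ j ∈ Finset.range N, φ (requestTime x j) =
      ∑ t ∈ Finset.range K, if Nat.count (fun s => x s = true) t < N then
        (if x t = true then φ t else 0) else 0 := by
  rw [← Finset.sum_filter, ← Finset.sum_filter]
  refine Finset.sum_nbij (requestTime x) ?_ ?_ ?_ (fun _ _ => rfl)
  · intro j hj
    have hj := Finset.mem_range.1 hj
    simp only [Finset.mem_filter, Finset.mem_range]
    refine ⟨⟨hK j hj, ?_⟩, Nat.nth_mem_of_infinite hx j⟩
    rw [requestTime, Nat.count_nth_of_infinite hx]
    exact hj
  · exact (Nat.nth_injective hx).injOn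
  · intro t ht
    simp only [Finset.coe_filter, Finset.mem_filter, Finset.mem_range, Set.mem_ofPred_eq] at ht
    exact ⟨Nat.count (fun s => x s = true) t, by simpa using ht.1.2,
      Nat.nth_count (p := fun s => x s = true) ht.2⟩

theorem requestTime_lt_of_lt (x : ℕ → Bool) (hx : {t | x t = true}.Infinite) {N j : ℕ}
    (hj : j < N) : requestTime x j < requestTime x (N - 1) + 1 :=
  Nat.lt_succ_of_le ((Nat.nth_monotone hx) (by omega))

/-- `Nat.count` up to `t` omits slot `t` itself. Hence the cut-off includes the slot of the N-th
request, yet is decided before slot `t`, as the independence argument needs. -/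
theorem count_lt_iff (x : ℕ → Bool) (hx : {t | x t = true}.Infinite) {N : ℕ} (hN : 1 ≤ N) (t : ℕ) :
    Nat.count (fun s => x s = true) t < N ↔ t < requestTime x (N - 1) + 1 := by
  constructor
  · intro h
    by_contra h'
    have h1 := Nat.count_monotone (fun s => x s = true) (not_lt.1 h')
    have h2 := Nat.count_nth_succ_of_infinite hx (N - 1)
    unfold requestTime at h1
    omega
  · intro h
    have h1 := Nat.count_monotone (fun s => x s = true) (Nat.lt_succ_iff.1 h)
    have h2 := Nat.count_nth_of_infinite hx (N - 1)
    unfold requestTime at h1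
    omega

theorem totalCost_eq_sum (f : ℝ≥0 → ℝ≥0) (p : ℝ≥0) (x u : ℕ → Bool)
    (hx : {t | x t = true}.Infinite) {N : ℕ} (hN : 1 ≤ N) :
    totalCost f p x u N = ∑ t ∈ Finset.range (requestTime x (N - 1) + 1),
      if Nat.count (fun s => x s = true) t < N then slotCost f p x u t else 0 := by
  have hsplit : ∀ t, (if Nat.count (fun s => x s = true) t < N then slotCost f p x u t else 0) =
      (if Nat.count (fun s => x s = true) t < N then
        (if x t = true then f (aoi u t) else 0) else 0) +
      (if Nat.count (fun s => x s = true) t < N then p * (if u t = true then 1 else 0) else 0) := by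
    intro t
    unfold slotCost
    split_ifs <;> simp
  simp_rw [hsplit]
  rw [Finset.sum_add_distrib, totalCost, sum_requestTime x hx N _
    (fun j hj => requestTime_lt_of_lt x hx hj) (fun t => f (aoi u t))]
  congr 1
  rw [numUpdates, Nat.count_eq_card_filter_range, Finset.card_filter, Nat.cast_sum, Finset.mul_sum]
  refine Finset.sum_congr rfl fun t ht => ?_
  rw [if_pos ((count_lt_iff x hx hN t).2 (Finset.mem_range.1 ht))]
  push_cast
  rfl

theorem totalCost_eq_tsum (f : ℝ≥0 → ℝ≥0) (p : ℝ≥0) (x u : ℕ → Bool)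
    (hx : {t | x t = true}.Infinite) {N : ℕ} (hN : 1 ≤ N) :
    (totalCost f p x u N : ℝ≥0∞) = ∑' t, ((if Nat.count (fun s => x s = true) t < N then
      slotCost f p x u t else 0 : ℝ≥0) : ℝ≥0∞) := by
  rw [totalCost_eq_sum f p x u hx hN, tsum_eq_sum (s := Finset.range (requestTime x (N - 1) + 1))]
  · push_cast; rfl
  · intro t ht
    rw [Finset.mem_range, ← count_lt_iff x hx hN] at ht
    rw [if_neg ht]; rfl

/-- Sums of increments up to a stopping index telescope. -/
theorem exists_sum_ite_telescope (P : ℕ → Prop) [DecidablePred P] (hP : ∀ t, P (t + 1) → P t)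
    (h : ℕ → ℝ) (K : ℕ) :
    ∃ m, (∑ t ∈ Finset.range K, if P t then h (t + 1) - h t else 0) = h m - h 0 ∧
      (P K → m = K) := by
  induction K with
  | zero => exact ⟨0, by simp⟩
  | succ K ih =>
    -- The second clause carries the induction: as long as `P` has not failed, the telescoped sum
    -- has reached the current index.
    obtain ⟨m, hm, hmK⟩ := ih
    by_cases hK : P K
    · refine ⟨K + 1, ?_, fun _ => rfl⟩
      rw [Finset.sum_range_succ, hm, if_pos hK, hmK hK]; ring
    · refine ⟨m, ?_, fun h' => absurd (hP K h') hK⟩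
      rw [Finset.sum_range_succ, hm, if_neg hK, add_zero]

/-! ### The relative value function: Poisson equation and Bellman inequality. -/

section Potential

variable (f : ℝ≥0 → ℝ≥0) (lam g : ℝ) (n : ℕ)

/-- The marginal staleness cost in excess of `g` below the threshold `n`. -/
noncomputable def excessCost (a : ℕ) : ℝ := if a < n then f a - g else 0

/-- The relative value of the age `a` under the threshold `n`. -/
noncomputable def relativeValue (a : ℕ) : ℝ := -lam * ∑ t ∈ Finset.Ico 1 a, excessCost f g n t

theorem relativeValue_succ {a : ℕ} (ha : 1 ≤ a) :
    relativeValue f lam g n (a + 1) = relativeValue f lam g n a - lam * excessCost f g n a := by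
  unfold relativeValue
  rw [Finset.sum_Ico_succ_top ha]; ring

theorem relativeValue_one : relativeValue f lam g n 1 = 0 := by simp [relativeValue]

theorem relativeValue_of_le {a : ℕ} (hn : 1 ≤ n) (ha : n ≤ a) :
    relativeValue f lam g n a = relativeValue f lam g n n := by
  induction a, ha using Nat.le_induction with
  | base => rfl
  | succ a ha ih =>
    rw [relativeValue_succ f lam g n (hn.trans ha), ih, excessCost, if_neg (by omega)]; ring

theorem relativeValue_threshold (hn : 1 ≤ n) :
    relativeValue f lam g n n = lam * (g * (n - 1) - ∑ t ∈ Finset.Ico 1 n, (f t : ℝ)) := by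
  have : ∑ t ∈ Finset.Ico 1 n, excessCost f g n t = ∑ t ∈ Finset.Ico 1 n, ((f t : ℝ) - g) :=
    Finset.sum_congr rfl fun t ht => by rw [excessCost, if_pos (Finset.mem_Ico.1 ht).2]
  rw [relativeValue, this, Finset.sum_sub_distrib]
  simp only [Finset.sum_const, Nat.card_Ico, nsmul_eq_mul]
  push_cast [hn]; ring

theorem exists_abs_excessCost_le : ∃ C, ∀ a, |excessCost f g n a| ≤ C := by
  refine ⟨∑ t ∈ Finset.range n, |(f t : ℝ) - g|, fun a => ?_⟩
  unfold excessCost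
  split_ifs with h
  · exact Finset.single_le_sum (f := fun t : ℕ => |(f t : ℝ) - g|) (fun _ _ => abs_nonneg _)
      (Finset.mem_range.2 h)
  · rw [abs_zero]; exact Finset.sum_nonneg fun _ _ => abs_nonneg _

/-- Cutting the excess off at `n` makes the relative value constant from `n` on. Its boundedness is
what makes the boundary term of the telescoping sum vanish after division by N. -/
theorem exists_abs_relativeValue_le (hn : 1 ≤ n) : ∃ C, ∀ a, |relativeValue f lam g n a| ≤ C := by
  refine ⟨∑ t ∈ Finset.range (n + 1), |relativeValue f lam g n t|, fun a => ?_⟩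
  have key : ∀ b ≤ n, |relativeValue f lam g n b| ≤
      ∑ t ∈ Finset.range (n + 1), |relativeValue f lam g n t| := fun b hb =>
    Finset.single_le_sum (f := fun t : ℕ => |relativeValue f lam g n t|) (fun _ _ => abs_nonneg _)
      (Finset.mem_range.2 (by omega))
  rcases le_total a n with h | h
  · exact key a h
  · rw [relativeValue_of_le f lam g n hn h]; exact key n le_rfl

variable {f lam g n} (p : ℝ≥0)

/-- The Poisson equation of the threshold updates. -/
theorem increment_thresholdUpdates (hn : 1 ≤ n)
    (hg : lam * ∑ t ∈ Finset.Ico 1 n, (f t : ℝ) + p = g * (lam * (n - 1) + 1))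
    (hf0 : f 0 = 0) (x : ℕ → Bool) (t : ℕ) :
    (slotCost f p x (thresholdUpdates n x) t : ℝ) - g * (if x t = true then 1 else 0) +
      (relativeValue f lam g n (aoiBefore (thresholdUpdates n x) (t + 1)) -
        relativeValue f lam g n (aoiBefore (thresholdUpdates n x) t)) =
      ((if x t = true then 1 else 0) - lam) *
        excessCost f g n (aoiBefore (thresholdUpdates n x) t) := by
  have hu := thresholdUpdates_eq_true_iff n x t
  have h1 := one_le_aoiBefore (thresholdUpdates n x) t
  rw [aoiBefore_succ, slotCost, aoi]
  generalize thresholdUpdates n x t = v at *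
  generalize aoiBefore (thresholdUpdates n x) t = a at *
  have hs := relativeValue_succ f lam g n h1
  have hn' := relativeValue_threshold f lam g n hn
  rcases lt_or_ge a n with ha | ha
  · have hv : v ≠ true := by rw [Ne, hu]; omega
    simp only [hv, if_false, Bool.false_eq_true, hs]
    rw [excessCost, if_pos ha]
    split_ifs <;> push_cast <;> ring
  · have hw : excessCost f g n a = 0 := by rw [excessCost, if_neg (by omega)]
    have ha' := relativeValue_of_le f lam g n hn ha
    by_cases hx : x t = true
    -- An update resets the value to 0, and `hg` says precisely that p − g − h(n) = 0.
    · have hv : v = true := hu.2 ⟨hx, ha⟩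
      simp only [hv, hx, if_true, Nat.cast_zero, hf0, zero_add, relativeValue_one, hw, ha', hn']
      push_cast
      linear_combination hg
    · have hv : v ≠ true := by rw [Ne, hu]; tauto
      simp only [hv, hx, if_false, Bool.false_eq_true, hs, hw]
      push_cast; ring

/-- The Bellman inequality for arbitrary updates. -/
theorem le_increment (hn : 1 ≤ n) (hlam0 : 0 < lam)
    (hg : lam * ∑ t ∈ Finset.Ico 1 n, (f t : ℝ) + p = g * (lam * (n - 1) + 1))
    (hf : Monotone f) (hlow : ∀ a : ℕ, 1 ≤ a → a < n → (f a : ℝ) ≤ g) (hup : g ≤ f n)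
    (hg0 : 0 ≤ g) (x u : ℕ → Bool) (t : ℕ) :
    ((if x t = true then 1 else 0) - lam) * excessCost f g n (aoiBefore u t) ≤
    (slotCost f p x u t : ℝ) - g * (if x t = true then 1 else 0) +
      (relativeValue f lam g n (aoiBefore u (t + 1)) - relativeValue f lam g n (aoiBefore u t)) := by
  have h1 := one_le_aoiBefore u t
  rw [aoiBefore_succ, slotCost, aoi]
  generalize aoiBefore u t = a at *
  have hs := relativeValue_succ f lam g n h1
  have hn' := relativeValue_threshold f lam g n hn
  have hmono : ∀ b : ℕ, 1 ≤ b → relativeValue f lam g n b ≤ relativeValue f lam g n (b + 1) := by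
    intro b hb
    rw [relativeValue_succ f lam g n hb, excessCost]
    split_ifs with h
    · nlinarith [hlow b hb h]
    · simp
  -- The value increases up to age `n`, where it equals the net cost p − g of updating at a request.
  have hmax : ∀ b : ℕ, 1 ≤ b → relativeValue f lam g n b ≤ p - g := by
    have hpn : relativeValue f lam g n n = p - g := by rw [hn']; linear_combination -hg
    intro b hb
    rcases le_total b n with h | h
    · rw [← hpn]
      have hchain : ∀ m, b ≤ m → relativeValue f lam g n b ≤ relativeValue f lam g n m :=
        fun m hm => Nat.le_induction le_rfl (fun k hk ih => ih.trans (hmono k (hb.trans hk))) m hm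
      exact hchain n h
    · rw [relativeValue_of_le f lam g n hn h, hpn]
  -- Used at `a + 1`, the bound reads p − g − h(a) ≥ −λ w(a). With w ≤ 0 this covers an update at a
  -- request, and with g ≥ 0 an update without one.
  have hm := hmax (a + 1) (by omega)
  have hf0 : (0 : ℝ) ≤ f (0 : ℕ) := NNReal.coe_nonneg _
  by_cases hv : u t = true
  · simp only [hv, if_true, zero_add, relativeValue_one]
    rw [hs] at hm
    have hw : excessCost f g n a ≤ 0 := by
      unfold excessCost; split_ifs with h
      · linarith [hlow a h1 h]
      · exact le_rfl
    by_cases hx : x t = true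
    · simp only [hx, if_true]; push_cast; push_cast at hf0; nlinarith
    · simp only [hx, if_false, Bool.false_eq_true]; push_cast; nlinarith
  · simp only [hv, if_false, Bool.false_eq_true, hs]
    by_cases hx : x t = true
    · simp only [hx, if_true]; push_cast
      unfold excessCost
      split_ifs with h
      · linarith
      · have : (f n : ℝ) ≤ f a := by exact_mod_cast hf (by exact_mod_cast not_lt.1 h)
        linarith
    · simp only [hx, if_false, Bool.false_eq_true]; push_cast; linarith

end Potential

/-! ### Measurability of ages, request counts and slot costs. -/

section Measurability

variable {Ω : Type*} {m : MeasurableSpace Ω}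

theorem measurable_aoiBefore {U : ℕ → Ω → Bool} (t : ℕ) (hU : ∀ s < t, Measurable (U s)) :
    Measurable fun ω => aoiBefore (fun s => U s ω) t := by
  induction t with
  | zero => exact measurable_const
  | succ t ih =>
    have h1 := ih fun s hs => hU s (by omega)
    have h2 : MeasurableSet {ω | U t ω = true} := hU t (by omega) (measurableSet_singleton true)
    exact (Measurable.ite h2 measurable_const h1).add_const 1

theorem measurable_aoi {U : ℕ → Ω → Bool} (t : ℕ) (hU : ∀ s, Measurable (U s)) :
    Measurable fun ω => aoi (fun s => U s ω) t :=
  Measurable.ite (hU t (measurableSet_singleton true)) measurable_const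
    (measurable_aoiBefore t fun s _ => hU s)

theorem measurable_count {X : ℕ → Ω → Bool} (t : ℕ) (hX : ∀ s < t, Measurable (X s)) :
    Measurable fun ω => Nat.count (fun s => X s ω = true) t := by
  induction t with
  | zero => simp only [Nat.count_zero]; exact measurable_const
  | succ t ih =>
    have h2 : MeasurableSet {ω | X t ω = true} := hX t (by omega) (measurableSet_singleton true)
    simp only [Nat.count_succ]
    exact (ih fun s hs => hX s (by omega)).add
      (Measurable.ite h2 measurable_const measurable_const)

theorem measurableSet_count_lt {X : ℕ → Ω → Bool} (N t : ℕ) (hX : ∀ s < t, Measurable (X s)) :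
    MeasurableSet {ω | Nat.count (fun s => X s ω = true) t < N} :=
  measurable_count t hX (Set.to_countable (Set.Iio N)).measurableSet

theorem measurable_thresholdAge {X : ℕ → Ω → Bool} (n t : ℕ) (hX : ∀ s < t, Measurable (X s)) :
    Measurable fun ω => thresholdAge n (fun s => X s ω) t := by
  induction t with
  | zero => exact measurable_const
  | succ t ih =>
    have h1 := ih fun s hs => hX s (by omega)
    have h2 : MeasurableSet {ω | X t ω = true} := hX t (by omega) (measurableSet_singleton true)
    have h3 : MeasurableSet {ω | n ≤ thresholdAge n (fun s => X s ω) t} :=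
      h1 (Set.to_countable (Set.Ici n)).measurableSet
    exact (Measurable.ite (h2.inter h3) measurable_const h1).add_const 1

theorem measurable_thresholdPolicy {X : ℕ → Ω → Bool} (n t : ℕ) (hX : ∀ s ≤ t, Measurable (X s)) :
    Measurable (thresholdPolicy X n t) := by
  have h1 := measurable_thresholdAge n t fun s hs => hX s hs.le
  have h2 : MeasurableSet {ω | X t ω = true} := hX t le_rfl (measurableSet_singleton true)
  have h3 : MeasurableSet {ω | n ≤ thresholdAge n (fun s => X s ω) t} :=
    h1 (Set.to_countable (Set.Ici n)).measurableSet
  refine measurable_to_bool ?_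
  convert h2.inter h3 using 1
  ext ω
  simp [thresholdPolicy, thresholdUpdates]

theorem measurable_slotCost (f : ℝ≥0 → ℝ≥0) (p : ℝ≥0) {X U : ℕ → Ω → Bool}
    (hX : ∀ t, Measurable (X t)) (hU : ∀ t, Measurable (U t)) (t : ℕ) :
    Measurable fun ω => slotCost f p (fun s => X s ω) (fun s => U s ω) t := by
  unfold slotCost
  exact (Measurable.ite (hX t (measurableSet_singleton true))
    ((measurable_of_countable fun a : ℕ => f a).comp (measurable_aoi t hU)) measurable_const).add
    (measurable_const.mul
      (Measurable.ite (hU t (measurableSet_singleton true)) measurable_const measurable_const))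

end Measurability

/-! ### Independence of past and present, and expectations of stopped sums. -/

section Arrivals

variable {Ω : Type*} [MeasurableSpace Ω] {μ : Measure Ω} {lam : ℝ}
  {X U : ℕ → Ω → Bool}

theorem isOnline_thresholdPolicy (hX : IsBernoulliArrivals μ X lam) (n : ℕ) :
    IsOnline μ X (thresholdPolicy X n) := by
  have hle : ∀ t, MeasurableSpace.comap (X t) ⊤ ≤ (inferInstance : MeasurableSpace Ω) :=
    fun t => (hX.measurable t).comap_le
  let ℱ : Filtration ℕ (inferInstance : MeasurableSpace Ω) :=
    { seq := fun t => ⨆ s ∈ Set.Iic t, MeasurableSpace.comap (X s) ⊤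
      mono' := fun a b hab => biSup_mono fun s hs => le_trans hs hab
      le' := fun t => iSup₂_le fun s _ => hle s }
  have hmeas : ∀ t, ∀ s ≤ t, Measurable[ℱ t] (X s) := fun t s hs =>
    Measurable.of_comap_le (le_iSup₂ (f := fun s (_ : s ∈ Set.Iic t) =>
      MeasurableSpace.comap (X s) ⊤) s hs)
  refine ⟨ℱ, fun t => hmeas t t le_rfl, fun t => measurable_thresholdPolicy n t (hmeas t),
    fun t => ?_⟩
  refine indep_iSup_of_disjoint hle hX.indep.iIndep ?_
  exact Set.disjoint_left.2 fun s hs hs' => not_lt.2 (Set.mem_Iic.1 hs) (Set.mem_Ioi.1 hs')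

/-- The information before slot `t` is independent of the arrival in slot `t`. -/
theorem IsOnline.exists_past [IsProbabilityMeasure μ] (hU : IsOnline μ X U) (t : ℕ) :
    ∃ m ≤ (inferInstance : MeasurableSpace Ω), Indep m (MeasurableSpace.comap (X t) ⊤) μ ∧
      (∀ s < t, Measurable[m] (X s)) ∧ ∀ s < t, Measurable[m] (U s) := by
  obtain ⟨ℱ, h1, h2, h3⟩ := hU
  cases t with
  -- Nothing precedes the first slot, so its past is trivial; later on the past is `ℱ` at the
  -- previous slot.
  | zero => exact ⟨⊥, bot_le, indep_bot_left _, by simp, by simp⟩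
  | succ t =>
    refine ⟨ℱ t, ℱ.le t, indep_of_indep_of_le_right (h3 t) ?_,
      fun s hs => (h1 s).mono (ℱ.mono (by omega)) le_rfl,
      fun s hs => (h2 s).mono (ℱ.mono (by omega)) le_rfl⟩
    exact le_iSup₂ (f := fun s (_ : s ∈ Set.Ioi t) => MeasurableSpace.comap (X s) ⊤) (t + 1)
      (Set.mem_Ioi.2 (by omega))

theorem IsOnline.measurable (hU : IsOnline μ X U) (t : ℕ) : Measurable (U t) := by
  obtain ⟨ℱ, _, h2, _⟩ := hU
  exact (h2 t).mono (ℱ.le t) le_rfl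

/-- Second Borel–Cantelli lemma. Off this null set no `Nat.nth` in `requestTime` takes its default
value 0. -/
theorem ae_infinite_requests [IsProbabilityMeasure μ] (hX : IsBernoulliArrivals μ X lam) (hlam0 : 0 < lam) :
    ∀ᵐ ω ∂μ, {t | X t ω = true}.Infinite := by
  have hms : ∀ t, MeasurableSet {ω | X t ω = true} := fun t =>
    hX.measurable t (measurableSet_singleton true)
  have hind : iIndepSet (fun t => {ω | X t ω = true}) μ := by
    rw [iIndepSet_iff_meas_biInter hms]
    intro s
    exact hX.indep.measure_inter_preimage_eq_mul s (sets := fun _ => {true})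
      fun i _ => measurableSet_singleton true
  have hsum : ∑' t, μ {ω | X t ω = true} = ∞ := by
    simp_rw [hX.prob]
    exact ENNReal.tsum_const_eq_top_of_ne_zero (by simpa using hlam0)
  have h := measure_limsup_eq_one hms hind hsum
  have hm : MeasurableSet (limsup (fun t => {ω | X t ω = true}) atTop) :=
    MeasurableSet.measurableSet_limsup hms
  filter_upwards [(prob_compl_eq_zero_iff hm).2 h] with ω hω
  have h' : ω ∈ limsup (fun t => {ω | X t ω = true}) atTop := by simpa using hω
  rw [mem_limsup_iff_frequently_mem] at h'
  exact Nat.frequently_atTop_iff_infinite.1 h'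

theorem integral_arrival (hX : IsBernoulliArrivals μ X lam) (hlam0 : 0 < lam) (t : ℕ) :
    ∫ ω, (if X t ω = true then 1 else 0 : ℝ) ∂μ = lam := by
  have hms : MeasurableSet {ω | X t ω = true} := hX.measurable t (measurableSet_singleton true)
  have : (fun ω => (if X t ω = true then 1 else 0 : ℝ)) =
      Set.indicator {ω | X t ω = true} (fun _ => 1) := by
    ext ω; simp [Set.indicator]
  rw [this, integral_indicator_const _ hms, measureReal_def, hX.prob, ENNReal.toReal_ofReal hlam0.le]
  simp

theorem measurable_arrival (hX : IsBernoulliArrivals μ X lam) (t : ℕ) :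
    Measurable fun ω => (if X t ω = true then 1 else 0 : ℝ) :=
  Measurable.ite (hX.measurable t (measurableSet_singleton true)) measurable_const measurable_const

theorem integrable_of_abs_le [IsProbabilityMeasure μ] {Y : Ω → ℝ} (hY : Measurable Y) (C : ℝ) (hC : ∀ ω, |Y ω| ≤ C) :
    Integrable Y μ :=
  Integrable.of_bound hY.aestronglyMeasurable C (ae_of_all _ hC)

theorem integrable_mul_arrival_sub {Ω : Type*} {m mΩ : MeasurableSpace Ω} {μ : Measure Ω}
    [IsProbabilityMeasure μ] {X : ℕ → Ω → Bool}
    (hX : IsBernoulliArrivals μ X lam) (hlam0 : 0 < lam) (t : ℕ) (hm : m ≤ mΩ)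
    (hind : Indep m (MeasurableSpace.comap (X t) ⊤) μ) {Y : Ω → ℝ} (hY : Measurable[m] Y)
    (C : ℝ) (hC : ∀ ω, |Y ω| ≤ C) :
    Integrable (fun ω => Y ω * ((if X t ω = true then 1 else 0) - lam)) μ ∧
      ∫ ω, Y ω * ((if X t ω = true then 1 else 0) - lam) ∂μ = 0 := by
  have hY' : Measurable Y := hY.mono hm le_rfl
  have h1 : IndepFun Y (X t) μ := by
    rw [IndepFun_iff_Indep]
    exact indep_of_indep_of_le_left hind hY.comap_le
  have h2 : IndepFun Y (fun ω => (if X t ω = true then 1 else 0) - lam) μ :=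
    h1.comp (φ := id) (ψ := fun b : Bool => (if b = true then 1 else 0 : ℝ) - lam) measurable_id
      (measurable_of_countable _)
  have h3 := measurable_arrival hX t
  have h4 : Integrable (fun ω => (if X t ω = true then 1 else 0 : ℝ)) μ := by
    refine integrable_of_abs_le h3 1 fun ω => ?_
    split_ifs <;> simp
  constructor
  · exact (h4.sub (integrable_const lam)).bdd_mul hY'.aestronglyMeasurable (ae_of_all _ hC)
  · rw [h2.integral_fun_mul_eq_mul_integral hY'.aestronglyMeasurable
      (h3.sub_const lam).aestronglyMeasurable, integral_sub h4 (integrable_const _),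
      integral_arrival hX hlam0]
    simp

/-- The accumulated deviation of the arrivals from their mean, weighted by a function of the age,
is centred. -/
theorem integral_sum_arrival_sub [IsProbabilityMeasure μ] (hX : IsBernoulliArrivals μ X lam) (hlam0 : 0 < lam)
    (hU : IsOnline μ X U) (w : ℕ → ℝ) (C : ℝ) (hC : ∀ a, |w a| ≤ C) (N K : ℕ) :
    Integrable (fun ω => ∑ t ∈ Finset.range K,
      if Nat.count (fun s => X s ω = true) t < N then
        ((if X t ω = true then 1 else 0) - lam) * w (aoiBefore (fun s => U s ω) t) else 0) μ ∧
    ∫ ω, (∑ t ∈ Finset.range K, if Nat.count (fun s => X s ω = true) t < N then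
      ((if X t ω = true then 1 else 0) - lam) * w (aoiBefore (fun s => U s ω) t) else 0) ∂μ = 0 := by
  have key : ∀ t, Integrable (fun ω => if Nat.count (fun s => X s ω = true) t < N then
        ((if X t ω = true then 1 else 0) - lam) * w (aoiBefore (fun s => U s ω) t) else 0) μ ∧
      ∫ ω, (if Nat.count (fun s => X s ω = true) t < N then
        ((if X t ω = true then 1 else 0) - lam) * w (aoiBefore (fun s => U s ω) t) else 0) ∂μ = 0 := by
    intro t
    obtain ⟨m, hm, hind, hXm, hUm⟩ := hU.exists_past t
    -- Both the age before slot `t` and the cut-off depend only on earlier slots, so the weight is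
    -- independent of the arrival in slot `t`.
    have hY : Measurable[m] fun ω => if Nat.count (fun s => X s ω = true) t < N then
        w (aoiBefore (fun s => U s ω) t) else 0 :=
      Measurable.ite (measurableSet_count_lt N t hXm)
        ((measurable_of_countable w).comp (measurable_aoiBefore t hUm)) measurable_const
    have heq : (fun ω => if Nat.count (fun s => X s ω = true) t < N then
        ((if X t ω = true then 1 else 0) - lam) * w (aoiBefore (fun s => U s ω) t) else 0) =
        fun ω => (if Nat.count (fun s => X s ω = true) t < N then
        w (aoiBefore (fun s => U s ω) t) else 0) * ((if X t ω = true then 1 else 0) - lam) := by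
      ext ω
      by_cases h : Nat.count (fun s => X s ω = true) t < N
      · simp only [h, if_true]; ring
      · simp only [h, if_false]; ring
    have hC0 : 0 ≤ C := (abs_nonneg _).trans (hC 0)
    rw [heq]
    refine integrable_mul_arrival_sub hX hlam0 t hm hind hY C fun ω => ?_
    split_ifs
    · exact hC _
    · simpa using hC0
  refine ⟨integrable_finsetSum _ fun t _ => (key t).1, ?_⟩
  rw [integral_finsetSum _ fun t _ => (key t).1]
  exact Finset.sum_eq_zero fun t _ => (key t).2

theorem slotCost_le {f : ℝ≥0 → ℝ≥0} (hf : Monotone f) (p : ℝ≥0) (x u : ℕ → Bool) (t : ℕ) :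
    slotCost f p x u t ≤ f (t + 1) + p := by
  have : f (aoi u t) ≤ f (t + 1) := hf (by exact_mod_cast aoi_le u t)
  unfold slotCost
  refine add_le_add ?_ ?_
  · split_ifs
    · exact this
    · exact zero_le
  · split_ifs <;> simp

theorem measurable_ite_slotCost (hX : IsBernoulliArrivals μ X lam) (hU : ∀ t, Measurable (U t))
    (f : ℝ≥0 → ℝ≥0) (p : ℝ≥0) (N t : ℕ) :
    Measurable fun ω => if Nat.count (fun s => X s ω = true) t < N then
        slotCost f p (fun s => X s ω) (fun s => U s ω) t else 0 :=
  Measurable.ite (measurableSet_count_lt N t fun s _ => hX.measurable s)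
    (measurable_slotCost f p hX.measurable hU t) measurable_const

/-- The age in slot `t` is at most t + 1, so the cost of one slot is bounded. The total cost need
not be integrable, as `f` may grow arbitrarily fast; hence the passage through finitely many slots.
-/
theorem integrable_ite_slotCost [IsProbabilityMeasure μ] (hX : IsBernoulliArrivals μ X lam) (hU : ∀ t, Measurable (U t))
    {f : ℝ≥0 → ℝ≥0} (hf : Monotone f) (p : ℝ≥0) (N t : ℕ) :
    Integrable (fun ω => ((if Nat.count (fun s => X s ω = true) t < N then
        slotCost f p (fun s => X s ω) (fun s => U s ω) t else 0 : ℝ≥0) : ℝ)) μ := by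
  refine integrable_of_abs_le (measurable_ite_slotCost hX hU f p N t).coe_nnreal_real
    ((f (t + 1) + p : ℝ≥0) : ℝ) fun ω => ?_
  rw [NNReal.abs_eq, NNReal.coe_le_coe]
  split_ifs
  · exact slotCost_le hf p _ _ t
  · exact zero_le

/-- The expected total cost is the limit of the expected costs in bounded time. -/
theorem tendsto_integral_sum_slotCost [IsProbabilityMeasure μ] (hX : IsBernoulliArrivals μ X lam) (hlam0 : 0 < lam)
    (hU : ∀ t, Measurable (U t)) {f : ℝ≥0 → ℝ≥0} (hf : Monotone f) (p : ℝ≥0) {N : ℕ} (hN : 1 ≤ N) :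
    Tendsto (fun K => ENNReal.ofReal (∫ ω, (∑ t ∈ Finset.range K,
      ((if Nat.count (fun s => X s ω = true) t < N then
        slotCost f p (fun s => X s ω) (fun s => U s ω) t else 0 : ℝ≥0) : ℝ)) ∂μ)) atTop
      (𝓝 (∫⁻ ω, (totalCost f p (fun t => X t ω) (fun t => U t ω) N : ℝ≥0∞) ∂μ)) := by
  have h1 : ∫⁻ ω, (totalCost f p (fun t => X t ω) (fun t => U t ω) N : ℝ≥0∞) ∂μ =
      ∑' t, ∫⁻ ω, ((if Nat.count (fun s => X s ω = true) t < N then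
        slotCost f p (fun s => X s ω) (fun s => U s ω) t else 0 : ℝ≥0) : ℝ≥0∞) ∂μ := by
    rw [← lintegral_tsum fun t =>
      (measurable_ite_slotCost hX hU f p N t).coe_nnreal_ennreal.aemeasurable]
    refine lintegral_congr_ae ?_
    filter_upwards [ae_infinite_requests hX hlam0] with ω hω
    exact totalCost_eq_tsum f p _ _ hω hN
  rw [h1]
  refine (ENNReal.tendsto_nat_tsum _).congr fun K => ?_
  have hint := fun t => integrable_ite_slotCost hX hU hf p N t
  rw [integral_finsetSum _ fun t _ => hint t,
    ENNReal.ofReal_sum_of_nonneg fun t _ => integral_nonneg fun ω => NNReal.coe_nonneg _]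
  refine Finset.sum_congr rfl fun t _ => ?_
  rw [ofReal_integral_eq_lintegral_ofReal (hint t) (ae_of_all _ fun ω => NNReal.coe_nonneg _)]
  simp_rw [ENNReal.ofReal_coe_nnreal]

theorem measurable_ite_arrival (hX : IsBernoulliArrivals μ X lam) (N t : ℕ) :
    Measurable fun ω => (if Nat.count (fun s => X s ω = true) t < N then
      (if X t ω = true then 1 else 0) else 0 : ℝ) :=
  Measurable.ite (measurableSet_count_lt N t fun s _ => hX.measurable s)
    (measurable_arrival hX t) measurable_const

theorem integrable_sum_arrival [IsProbabilityMeasure μ] (hX : IsBernoulliArrivals μ X lam) (N K : ℕ) :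
    Integrable (fun ω => ∑ t ∈ Finset.range K,
      (if Nat.count (fun s => X s ω = true) t < N then
        (if X t ω = true then 1 else 0) else 0 : ℝ)) μ := by
  refine integrable_finsetSum _ fun t _ => ?_
  refine integrable_of_abs_le (measurable_ite_arrival hX N t) 1 fun ω => ?_
  split_ifs <;> simp

/-- The requests counted increase to N almost surely and never exceed it, so dominated convergence
applies. -/
theorem tendsto_integral_sum_arrival [IsProbabilityMeasure μ] (hX : IsBernoulliArrivals μ X lam) (hlam0 : 0 < lam) (N : ℕ) :
    Tendsto (fun K => ∫ ω, (∑ t ∈ Finset.range K,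
      (if Nat.count (fun s => X s ω = true) t < N then
        (if X t ω = true then 1 else 0) else 0 : ℝ)) ∂μ) atTop (𝓝 N) := by
  have hlim : ∀ᵐ ω ∂μ, ∀ᶠ K in atTop, (∑ t ∈ Finset.range K,
      (if Nat.count (fun s => X s ω = true) t < N then
        (if X t ω = true then 1 else 0) else 0 : ℝ)) = N := by
    filter_upwards [ae_infinite_requests hX hlam0] with ω hω
    filter_upwards [eventually_ge_atTop (requestTime (fun s => X s ω) (N - 1) + 1)] with K hK
    have := sum_requestTime (fun s => X s ω) hω N K
      (fun j hj => (requestTime_lt_of_lt _ hω hj).trans_le hK) (fun _ => (1 : ℝ))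
    rw [← this]; simp
  have hmono : ∀ ω, Monotone fun K => ∑ t ∈ Finset.range K,
      (if Nat.count (fun s => X s ω = true) t < N then
        (if X t ω = true then 1 else 0) else 0 : ℝ) := fun ω => by
    refine monotone_nat_of_le_succ fun K => ?_
    rw [Finset.sum_range_succ, le_add_iff_nonneg_right]
    split_ifs <;> simp
  have h0 : (N : ℝ) = ∫ _, (N : ℝ) ∂μ := by simp
  rw [h0]
  refine tendsto_integral_of_dominated_convergence (fun _ => (N : ℝ))
    (fun K => (integrable_sum_arrival hX N K).aestronglyMeasurable) (integrable_const _)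
    (fun K => ?_) ?_
  · filter_upwards [hlim] with ω hω
    obtain ⟨K', h1, h2⟩ := (hω.and (eventually_ge_atTop K)).exists
    rw [Real.norm_eq_abs, abs_of_nonneg]
    · exact (hmono ω h2).trans h1.le
    · have := hmono ω (Nat.zero_le K)
      simpa using this
  · filter_upwards [hlim] with ω hω
    exact tendsto_const_nhds.congr' (hω.mono fun K hK => hK.symm)

end Arrivals

/-! ### Bounds on the expected cost, and average costs. -/

section Cost

variable {Ω : Type*} [MeasurableSpace Ω] {μ : Measure Ω} [IsProbabilityMeasure μ] {lam : ℝ}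
  {X U : ℕ → Ω → Bool}

theorem abs_sum_ite_telescope_le (x : ℕ → Bool) (h : ℕ → ℝ) (C : ℝ) (hC : ∀ t, |h t| ≤ C)
    (N K : ℕ) :
    |∑ t ∈ Finset.range K, if Nat.count (fun s => x s = true) t < N then
      h (t + 1) - h t else 0| ≤ 2 * C := by
  obtain ⟨m, hm, -⟩ := exists_sum_ite_telescope (fun t => Nat.count (fun s => x s = true) t < N)
    (fun t ht => (Nat.count_monotone _ t.le_succ).trans_lt ht) h K
  rw [hm]
  refine (abs_sub _ _).trans ?_
  linarith [hC m, hC 0]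

/-- Within `K` slots everything is integrable and the weighted deviation has mean zero; then `K`
tends to infinity. The loss 2C comes from the two ends of the telescoping sum. Keeping `h` and `w`
abstract lets the Poisson equation and the Bellman inequality share the lemma. -/
theorem ofReal_le_lintegral_totalCost (hX : IsBernoulliArrivals μ X lam) (hlam0 : 0 < lam)
    (hU : IsOnline μ X U) {f : ℝ≥0 → ℝ≥0} (hf : Monotone f) (p : ℝ≥0) (g : ℝ) (h w : ℕ → ℝ)
    (C C' : ℝ) (hh : ∀ a, |h a| ≤ C) (hw : ∀ a, |w a| ≤ C')
    (hinc : ∀ ω t, ((if X t ω = true then 1 else 0) - lam) * w (aoiBefore (fun s => U s ω) t) ≤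
      (slotCost f p (fun s => X s ω) (fun s => U s ω) t : ℝ) - g * (if X t ω = true then 1 else 0) +
        (h (aoiBefore (fun s => U s ω) (t + 1)) - h (aoiBefore (fun s => U s ω) t)))
    {N : ℕ} (hN : 1 ≤ N) :
    ENNReal.ofReal (g * N - 2 * C) ≤
      ∫⁻ ω, (totalCost f p (fun t => X t ω) (fun t => U t ω) N : ℝ≥0∞) ∂μ := by
  refine le_of_tendsto_of_tendsto' (ENNReal.tendsto_ofReal
    (((tendsto_integral_sum_arrival hX hlam0 N).const_mul g).sub_const (2 * C)))
    (tendsto_integral_sum_slotCost hX hlam0 hU.measurable hf p hN) fun K =>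
      ENNReal.ofReal_le_ofReal ?_
  obtain ⟨hint, hzero⟩ := integral_sum_arrival_sub hX hlam0 hU w C' hw N K
  have hB := (integrable_sum_arrival hX N K).const_mul g
  have hA := integrable_finsetSum (Finset.range K)
    fun t _ => integrable_ite_slotCost hX hU.measurable hf p N t
  have := integral_mono ((hint.add hB).sub (integrable_const (2 * C))) hA fun ω => ?_
  · rw [integral_sub' (hint.add hB) (integrable_const _), integral_add' hint hB, hzero,
      integral_const_mul] at this
    simpa using this
  · have htel := (abs_le.1 (abs_sum_ite_telescope_le (fun s => X s ω)
      (fun t => h (aoiBefore (fun s => U s ω) t)) C (fun t => hh _) N K)).2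
    have hsum := Finset.sum_le_sum fun t (_ : t ∈ Finset.range K) =>
      show (if Nat.count (fun s => X s ω = true) t < N then
          ((if X t ω = true then 1 else 0) - lam) * w (aoiBefore (fun s => U s ω) t) else 0) +
        g * (if Nat.count (fun s => X s ω = true) t < N then
          (if X t ω = true then 1 else 0) else 0) ≤
        ((if Nat.count (fun s => X s ω = true) t < N then
          slotCost f p (fun s => X s ω) (fun s => U s ω) t else 0 : ℝ≥0) : ℝ) +
        (if Nat.count (fun s => X s ω = true) t < N then
          h (aoiBefore (fun s => U s ω) (t + 1)) - h (aoiBefore (fun s => U s ω) t) else 0) from by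
      have := hinc ω t
      by_cases hc : Nat.count (fun s => X s ω = true) t < N
      · simp only [hc, if_true]; linarith
      · simp only [hc, if_false]; simp
    rw [Finset.sum_add_distrib, Finset.sum_add_distrib, ← Finset.mul_sum] at hsum
    simp only [Pi.add_apply, Pi.sub_apply]
    linarith

theorem lintegral_totalCost_le_ofReal (hX : IsBernoulliArrivals μ X lam) (hlam0 : 0 < lam)
    (hU : IsOnline μ X U) {f : ℝ≥0 → ℝ≥0} (hf : Monotone f) (p : ℝ≥0) (g : ℝ) (h w : ℕ → ℝ)
    (C C' : ℝ) (hh : ∀ a, |h a| ≤ C) (hw : ∀ a, |w a| ≤ C')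
    (hinc : ∀ ω t, (slotCost f p (fun s => X s ω) (fun s => U s ω) t : ℝ) -
      g * (if X t ω = true then 1 else 0) +
        (h (aoiBefore (fun s => U s ω) (t + 1)) - h (aoiBefore (fun s => U s ω) t)) ≤
      ((if X t ω = true then 1 else 0) - lam) * w (aoiBefore (fun s => U s ω) t))
    {N : ℕ} (hN : 1 ≤ N) :
    ∫⁻ ω, (totalCost f p (fun t => X t ω) (fun t => U t ω) N : ℝ≥0∞) ∂μ ≤
      ENNReal.ofReal (g * N + 2 * C) := by
  refine le_of_tendsto_of_tendsto'
    (tendsto_integral_sum_slotCost hX hlam0 hU.measurable hf p hN) (ENNReal.tendsto_ofReal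
    (((tendsto_integral_sum_arrival hX hlam0 N).const_mul g).add_const (2 * C))) fun K =>
      ENNReal.ofReal_le_ofReal ?_
  obtain ⟨hint, hzero⟩ := integral_sum_arrival_sub hX hlam0 hU w C' hw N K
  have hB := (integrable_sum_arrival hX N K).const_mul g
  have hA := integrable_finsetSum (Finset.range K)
    fun t _ => integrable_ite_slotCost hX hU.measurable hf p N t
  have := integral_mono hA ((hint.add hB).add (integrable_const (2 * C))) fun ω => ?_
  · rw [integral_add' (hint.add hB) (integrable_const _), integral_add' hint hB, hzero,
      integral_const_mul] at this
    simpa using this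
  · have htel := (abs_le.1 (abs_sum_ite_telescope_le (fun s => X s ω)
      (fun t => h (aoiBefore (fun s => U s ω) t)) C (fun t => hh _) N K)).1
    have hsum := Finset.sum_le_sum fun t (_ : t ∈ Finset.range K) =>
      show
        ((if Nat.count (fun s => X s ω = true) t < N then
          slotCost f p (fun s => X s ω) (fun s => U s ω) t else 0 : ℝ≥0) : ℝ) +
        (if Nat.count (fun s => X s ω = true) t < N then
          h (aoiBefore (fun s => U s ω) (t + 1)) - h (aoiBefore (fun s => U s ω) t) else 0) ≤
        (if Nat.count (fun s => X s ω = true) t < N then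
          ((if X t ω = true then 1 else 0) - lam) * w (aoiBefore (fun s => U s ω) t) else 0) +
        g * (if Nat.count (fun s => X s ω = true) t < N then
          (if X t ω = true then 1 else 0) else 0) from by
      have := hinc ω t
      by_cases hc : Nat.count (fun s => X s ω = true) t < N
      · simp only [hc, if_true]; linarith
      · simp only [hc, if_false]; simp
    rw [Finset.sum_add_distrib, Finset.sum_add_distrib, ← Finset.mul_sum] at hsum
    simp only [Pi.add_apply]
    linarith

theorem tendsto_ofReal_affine_div (g C : ℝ) :
    Tendsto (fun N : ℕ => ENNReal.ofReal (g * N + C) / N) atTop (𝓝 (ENNReal.ofReal g)) := by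
  have h1 : Tendsto (fun N : ℕ => g + C / N) atTop (𝓝 (g + 0)) :=
    (tendsto_const_div_atTop_nhds_zero_nat C).const_add g
  rw [add_zero] at h1
  refine (ENNReal.tendsto_ofReal h1).congr' ?_
  filter_upwards [eventually_ge_atTop 1] with N hN
  have hN' : (0 : ℝ) < N := by exact_mod_cast hN
  rw [← ENNReal.ofReal_natCast, ← ENNReal.ofReal_div_of_pos hN']
  congr 1
  field_simp

/-- The average cost of a threshold policy. -/
theorem tendsto_costPerRequest_thresholdPolicy (hX : IsBernoulliArrivals μ X lam)
    (hlam0 : 0 < lam) {f : ℝ≥0 → ℝ≥0} (hf : Monotone f) (hf0 : f 0 = 0) (p : ℝ≥0)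
    {n : ℕ} (hn : 1 ≤ n) {g : ℝ}
    (hg : lam * ∑ t ∈ Finset.Ico 1 n, (f t : ℝ) + p = g * (lam * (n - 1) + 1)) :
    Tendsto (costPerRequest μ f p X (thresholdPolicy X n)) atTop (𝓝 (ENNReal.ofReal g)) := by
  obtain ⟨C, hC⟩ := exists_abs_relativeValue_le f lam g n hn
  obtain ⟨C', hC'⟩ := exists_abs_excessCost_le f g n
  have hU := isOnline_thresholdPolicy hX n
  have hupper := fun N hN => lintegral_totalCost_le_ofReal hX hlam0 hU hf p g
    (relativeValue f lam g n) (excessCost f g n) C C' hC hC'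
    (fun ω t => (increment_thresholdUpdates p hn hg hf0 (fun s => X s ω) t).le) (N := N) hN
  have hlower := fun N hN => ofReal_le_lintegral_totalCost hX hlam0 hU hf p g
    (relativeValue f lam g n) (excessCost f g n) C C' hC hC'
    (fun ω t => (increment_thresholdUpdates p hn hg hf0 (fun s => X s ω) t).ge) (N := N) hN
  refine tendsto_of_tendsto_of_tendsto_of_le_of_le' (tendsto_ofReal_affine_div g (-(2 * C)))
    (tendsto_ofReal_affine_div g (2 * C)) ?_ ?_
  · filter_upwards [eventually_ge_atTop 1] with N hN
    exact ENNReal.div_le_div_right (hlower N hN) _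
  · filter_upwards [eventually_ge_atTop 1] with N hN
    exact ENNReal.div_le_div_right (hupper N hN) _

/-- A threshold at which the marginal staleness cost crosses the average cost gives a lower bound
on the average cost of every online policy. -/
theorem ofReal_le_averageCost (hX : IsBernoulliArrivals μ X lam)
    (hlam0 : 0 < lam) (hU : IsOnline μ X U) {f : ℝ≥0 → ℝ≥0} (hf : Monotone f) (p : ℝ≥0)
    {n : ℕ} (hn : 1 ≤ n) {g : ℝ} (hg0 : 0 ≤ g)
    (hg : lam * ∑ t ∈ Finset.Ico 1 n, (f t : ℝ) + p = g * (lam * (n - 1) + 1))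
    (hlow : ∀ a : ℕ, 1 ≤ a → a < n → (f a : ℝ) ≤ g) (hup : g ≤ f n) :
    ENNReal.ofReal g ≤ averageCost μ f p X U := by
  obtain ⟨C, hC⟩ := exists_abs_relativeValue_le f lam g n hn
  obtain ⟨C', hC'⟩ := exists_abs_excessCost_le f g n
  rw [averageCost, ← (tendsto_ofReal_affine_div g (-(2 * C))).liminf_eq]
  refine liminf_le_liminf ?_
  filter_upwards [eventually_ge_atTop 1] with N hN
  exact ENNReal.div_le_div_right (ofReal_le_lintegral_totalCost hX hlam0 hU hf p g
    (relativeValue f lam g n) (excessCost f g n) C C' hC hC'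
    (fun ω t => le_increment p hn hlam0 hg hf hlow hup hg0 (fun s => X s ω)
      (fun s => U s ω) t) hN) _

end Cost

/-! ### Existence of an extension and of a minimizer. -/

section Extension

/-- The piecewise linear extension of the sums. -/
noncomputable def linearInterpolation (f : ℝ≥0 → ℝ≥0) (τ : ℝ) : ℝ :=
  ∑ t ∈ Finset.Ico 1 ⌊τ⌋₊, (f t : ℝ) + f ⌊τ⌋₊ * (τ - ⌊τ⌋₊)

variable {f : ℝ≥0 → ℝ≥0}

theorem sum_Ico_one_succ (hf0 : f 0 = 0) (n : ℕ) :
    ∑ t ∈ Finset.Ico 1 (n + 1), (f t : ℝ) = ∑ t ∈ Finset.Ico 1 n, (f t : ℝ) + f n := by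
  rcases Nat.eq_zero_or_pos n with rfl | hn
  · simp [hf0]
  · exact Finset.sum_Ico_succ_top hn _

/-- Discrete convexity: the increments `f` of the sums are non-decreasing. Since f(0) = 0, the index
0 fits in as well. -/
theorem sum_add_mul_le_sum (hf : Monotone f) (hf0 : f 0 = 0) (n m : ℕ) :
    ∑ t ∈ Finset.Ico 1 n, (f t : ℝ) + f n * ((m : ℝ) - n) ≤ ∑ t ∈ Finset.Ico 1 m, (f t : ℝ) := by
  rcases le_total n m with h | h
  · induction m, h using Nat.le_induction with
    | base => simp
    | succ m hm ih =>
      have : (f n : ℝ) ≤ f m := by exact_mod_cast hf (by exact_mod_cast hm)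
      rw [sum_Ico_one_succ hf0]; push_cast; linarith
  · induction n, h using Nat.le_induction with
    | base => simp
    | succ n hn ih =>
      have h1 : (f n : ℝ) ≤ f (n + 1 : ℕ) := by
        exact_mod_cast hf (by exact_mod_cast n.le_succ)
      have h2 : (m : ℝ) ≤ n := by exact_mod_cast hn
      rw [sum_Ico_one_succ hf0]
      push_cast at h1 ⊢; nlinarith

theorem isSumExtension_linearInterpolation (hf : Monotone f) (hf0 : f 0 = 0) :
    IsSumExtension f (linearInterpolation f) where
  eq_sum n _ := by simp [linearInterpolation]
  above_line n hn τ hτ hout := by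
    have hfl := Nat.floor_le hτ.le
    have hlt := Nat.lt_floor_add_one τ
    simp only [linearInterpolation, Nat.floor_natCast, sub_self, mul_zero, add_zero]
    generalize ⌊τ⌋₊ = m at *
    rcases le_or_gt n m with h | h
    · have h1 := sum_add_mul_le_sum hf hf0 n m
      have h2 : (f n : ℝ) ≤ f m := by exact_mod_cast hf (by exact_mod_cast h)
      nlinarith
    -- Left of `n`, τ is reached backwards from m + 1 along a slope f(m) ≤ f(n), so the right
    -- endpoint is the one to compare with.
    · have h1 := sum_add_mul_le_sum hf hf0 n (m + 1)
      rw [sum_Ico_one_succ hf0] at h1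
      have h2 : (f m : ℝ) ≤ f n := by exact_mod_cast hf (by exact_mod_cast h.le)
      push_cast at h1
      nlinarith

theorem denominator_pos {lam τ : ℝ} (hlam0 : 0 < lam) (hlam1 : lam < 1) (hτ : 0 < τ) :
    0 < lam * (τ - 1) + 1 := by nlinarith

theorem closedFormCost_mul {p : ℝ≥0} {lam : ℝ} {S : ℝ → ℝ} (hlam0 : 0 < lam) (hlam1 : lam < 1) {τ : ℝ} (hτ : 0 < τ) :
    lam * S τ + p = closedFormCost lam p S τ * (lam * (τ - 1) + 1) := by
  rw [closedFormCost, div_mul_cancel₀ _ (denominator_pos hlam0 hlam1 hτ).ne']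

theorem le_closedFormCost_iff {p : ℝ≥0} {lam : ℝ} {S : ℝ → ℝ} (hlam0 : 0 < lam) (hlam1 : lam < 1) {τ g : ℝ} (hτ : 0 < τ) :
    g ≤ closedFormCost lam p S τ ↔ g * (lam * (τ - 1) + 1) ≤ lam * S τ + p :=
  le_div_iff₀ (denominator_pos hlam0 hlam1 hτ)

/-- A minimum g over finitely many integers is global: g ≤ F(1) = p, and past `a` each further term
of the sum is at least p ≥ g, so F cannot drop below g. -/
theorem exists_isMinOn_closedFormCost (hf : Monotone f) (hf0 : f 0 = 0) {p : ℝ≥0} {lam : ℝ}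
    (hlam0 : 0 < lam) (hlam1 : lam < 1) {a : ℝ≥0} (ha : p ≤ f a) :
    ∃ τ' : ℝ, 0 < τ' ∧
      IsMinOn (closedFormCost lam p (linearInterpolation f)) (Set.Ioi 0) τ' := by
  set S := fun n : ℕ => ∑ t ∈ Finset.Ico 1 n, (f t : ℝ) with hS
  obtain ⟨n, hn, hmin⟩ := Finset.exists_min_image (Finset.Icc 1 (⌈a⌉₊ + 1))
    (fun n : ℕ => closedFormCost lam p (linearInterpolation f) n) ⟨1, by simp⟩
  have hn1 : (0 : ℝ) < n := by exact_mod_cast (Finset.mem_Icc.1 hn).1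
  refine ⟨n, hn1, isMinOn_iff.2 ?_⟩
  have hgp : closedFormCost lam p (linearInterpolation f) n ≤ p := by
    refine (hmin 1 (by simp)).trans (le_of_eq ?_)
    simp [closedFormCost, linearInterpolation]
  generalize closedFormCost lam p (linearInterpolation f) n = g at *
  have hG : ∀ m : ℕ, 1 ≤ m → g * (lam * (m - 1) + 1) ≤ lam * S m + p := by
    have hsmall : ∀ m : ℕ, 1 ≤ m → m ≤ ⌈a⌉₊ + 1 → g * (lam * (m - 1) + 1) ≤ lam * S m + p := by
      intro m hm hm'
      have hm0 : (0 : ℝ) < m := by exact_mod_cast hm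
      have := (le_closedFormCost_iff hlam0 hlam1 hm0).1 (hmin m (Finset.mem_Icc.2 ⟨hm, hm'⟩))
      simpa [linearInterpolation, hS] using this
    intro m hm
    rcases le_total m (⌈a⌉₊ + 1) with h | h
    · exact hsmall m hm h
    · clear hm
      induction m, h using Nat.le_induction with
      | base => exact hsmall _ (by omega) le_rfl
      | succ m hm ih =>
        have h1 : a ≤ m := (Nat.le_ceil a).trans (by exact_mod_cast (by omega : ⌈a⌉₊ ≤ m))
        have h2 : (p : ℝ) ≤ f m := by exact_mod_cast ha.trans (hf h1)
        have h3 : S (m + 1) = S m + f m := sum_Ico_one_succ hf0 m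
        rw [h3]; push_cast; nlinarith
  intro τ hτ
  have hτ : 0 < τ := hτ
  rw [le_closedFormCost_iff hlam0 hlam1 hτ]
  have hfl := Nat.floor_le hτ.le
  have hlt := Nat.lt_floor_add_one τ
  have hd := denominator_pos hlam0 hlam1 hτ
  have hp : (0 : ℝ) ≤ p := p.coe_nonneg
  unfold linearInterpolation
  generalize ⌊τ⌋₊ = m at *
  -- Below 1 the numerator is p and the denominator is less than 1, so F ≥ p ≥ g.
  rcases Nat.eq_zero_or_pos m with rfl | hm
  · simp only [Nat.cast_zero, zero_add] at hlt
    have h1 : g * (lam * (τ - 1) + 1) ≤ p * (lam * (τ - 1) + 1) :=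
      mul_le_mul_of_nonneg_right hgp hd.le
    have h2 : (p : ℝ) * (lam * (τ - 1) + 1) ≤ p * 1 :=
      mul_le_mul_of_nonneg_left (by nlinarith) hp
    simp [hf0]
    linarith
  · have h1 := hG m hm
    have h2 := hG (m + 1) (by omega)
    have h3 : S (m + 1) = S m + f m := sum_Ico_one_succ hf0 m
    rw [h3] at h2
    push_cast at h2
    -- Between integers, numerator and denominator of F are both affine, so the inequality is a
    -- convex combination of those at the endpoints.
    have h4 := mul_le_mul_of_nonneg_left h1 (by linarith : 0 ≤ (m : ℝ) + 1 - τ)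
    have h5 := mul_le_mul_of_nonneg_left h2 (sub_nonneg.2 hfl)
    change _ ≤ lam * (S m + _) + _
    linarith

end Extension

/-! ### The crossing property of the best rounding. -/

section Optimality

variable {f : ℝ≥0 → ℝ≥0} {p : ℝ≥0} {lam : ℝ} {S : ℝ → ℝ}

theorem IsSumExtension.succ (hS : IsSumExtension f S) {n : ℕ} (hn : 1 ≤ n) :
    S ((n + 1 : ℕ) : ℝ) = S n + f n := by
  rw [hS.eq_sum n hn, hS.eq_sum (n + 1) (by omega), Finset.sum_Ico_succ_top hn]

/-- From n to n + 1 the numerator of F gains λ f(n) and the denominator λ, so F(n + 1) is a weighted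
mean of F(n) and f(n). -/
theorem IsSumExtension.le_apply_of_le_succ (hS : IsSumExtension f S) (hlam0 : 0 < lam)
    (hlam1 : lam < 1) {n : ℕ} (hn : 1 ≤ n)
    (h : closedFormCost lam p S n ≤ closedFormCost lam p S (n + 1 : ℕ)) :
    closedFormCost lam p S n ≤ f n := by
  have hn0 : (0 : ℝ) < n := by exact_mod_cast hn
  rw [le_closedFormCost_iff hlam0 hlam1 (by positivity), hS.succ hn] at h
  have h1 := closedFormCost_mul (p := p) (S := S) hlam0 hlam1 hn0
  push_cast at h
  refine le_of_mul_le_mul_left ?_ hlam0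
  linarith

theorem IsSumExtension.apply_le_of_succ_le (hS : IsSumExtension f S) (hlam0 : 0 < lam)
    (hlam1 : lam < 1) {n : ℕ} (hn : 1 ≤ n)
    (h : closedFormCost lam p S (n + 1 : ℕ) ≤ closedFormCost lam p S n) :
    (f n : ℝ) ≤ closedFormCost lam p S (n + 1 : ℕ) := by
  have hn0 : (0 : ℝ) < n := by exact_mod_cast hn
  rw [le_closedFormCost_iff hlam0 hlam1 hn0] at h
  have h1 := closedFormCost_mul (p := p) (S := S) hlam0 hlam1 (τ := (n + 1 : ℕ)) (by positivity)
  rw [hS.succ hn] at h1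
  push_cast at h h1 ⊢
  refine le_of_mul_le_mul_left ?_ hlam0
  linarith

/-- A best rounding of a minimizer is where the marginal cost crosses the closed-form cost. -/
theorem IsSumExtension.crossing (hS : IsSumExtension f S) (hlam0 : 0 < lam) (hlam1 : lam < 1)
    {τ' : ℝ} (hτ' : 0 < τ') (hmin : IsMinOn (closedFormCost lam p S) (Set.Ioi 0) τ')
    {n : ℕ} (hn : 1 ≤ n) (hround : n = ⌊τ'⌋₊ ∨ n = ⌈τ'⌉₊)
    (hbest : ∀ m : ℕ, 1 ≤ m → (m = ⌊τ'⌋₊ ∨ m = ⌈τ'⌉₊) →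
      closedFormCost lam p S n ≤ closedFormCost lam p S m) :
    closedFormCost lam p S n ≤ f n ∧
      (2 ≤ n → (f (n - 1 : ℕ) : ℝ) ≤ closedFormCost lam p S n) := by
  have hn0 : (0 : ℝ) < n := by exact_mod_cast hn
  have hmin' : ∀ τ : ℝ, 0 < τ → closedFormCost lam p S τ' ≤ closedFormCost lam p S τ :=
    fun τ hτ => hmin hτ
  have hFn := closedFormCost_mul (p := p) (S := S) hlam0 hlam1 hn0
  have hFτ := closedFormCost_mul (p := p) (S := S) hlam0 hlam1 hτ'
  have hle : lam * S τ' + p ≤ closedFormCost lam p S n * (lam * (τ' - 1) + 1) := by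
    rw [hFτ]
    exact mul_le_mul_of_nonneg_right (hmin' n hn0) (denominator_pos hlam0 hlam1 hτ').le
  have hfl := Nat.floor_le hτ'.le
  have hlt := Nat.lt_floor_add_one τ'
  -- If τ' is an integer, both roundings equal it, and minimality against its integer neighbours
  -- suffices.
  rcases hfl.eq_or_lt with heq | hfl'
  · have hnτ : (n : ℝ) = τ' := by
      rcases hround with h | h
      · rw [h, heq]
      · rw [h, ← heq, Nat.ceil_natCast]
    refine ⟨hS.le_apply_of_le_succ hlam0 hlam1 hn ?_, fun h2 => ?_⟩
    · rw [hnτ]; exact hmin' _ (by positivity)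
    · obtain ⟨k, rfl⟩ : ∃ k, n = k + 1 := ⟨n - 1, by omega⟩
      rw [Nat.add_sub_cancel]
      refine hS.apply_le_of_succ_le hlam0 hlam1 (by omega) ?_
      rw [hnτ]; exact hmin' _ (by exact_mod_cast (by omega : 0 < k))
  · have hceil : ⌈τ'⌉₊ = ⌊τ'⌋₊ + 1 := by
      refine le_antisymm (Nat.ceil_le.2 (by push_cast; exact hlt.le)) ?_
      exact Nat.succ_le_of_lt (Nat.lt_ceil.2 hfl')
    rw [hceil] at hround hbest
    generalize ⌊τ'⌋₊ = m at *
    rcases hround with rfl | rfl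
    · refine ⟨hS.le_apply_of_le_succ hlam0 hlam1 hn (hbest _ (by omega) (Or.inr rfl)),
        fun h2 => ?_⟩
      obtain ⟨k, rfl⟩ : ∃ k, n = k + 1 := ⟨n - 1, by omega⟩
      rw [Nat.add_sub_cancel]
      -- Here n = k + 1 < τ'. If f(k) > F(n), then S lies at τ' on or above the line of slope f(k)
      -- through (n, S(n)), which forces F(τ') > F(n).
      by_contra! hlt'
      have h3 := hS.above_line k (by omega) τ' hτ' (Or.inr (by push_cast at hfl'; exact hfl'.le))
      rw [hS.succ (by omega : 1 ≤ k)] at hFn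
      have h4 := mul_lt_mul_of_pos_left hlt' (mul_pos hlam0 (sub_pos.2 hfl'))
      have h5 := mul_le_mul_of_nonneg_left h3 hlam0.le
      push_cast at *
      linarith
    · refine ⟨?_, fun h2 => ?_⟩
      -- The mirror image: τ' < n, and going left from n along a slope f(n) < F(n) again forces
      -- F(τ') > F(n).
      · by_contra! hlt'
        have hlt : τ' < (m + 1 : ℕ) := by push_cast; exact hlt
        have h3 := hS.above_line (m + 1) hn τ' hτ' (Or.inl hlt.le)
        have h4 := mul_lt_mul_of_pos_left hlt' (mul_pos hlam0 (sub_pos.2 hlt))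
        have h5 := mul_le_mul_of_nonneg_left h3 hlam0.le
        linarith
      · rw [Nat.add_sub_cancel]
        exact hS.apply_le_of_succ_le hlam0 hlam1 (by omega) (hbest m (by omega) (Or.inl rfl))

theorem IsSumExtension.closedFormCost_nonneg (hS : IsSumExtension f S) (hlam0 : 0 < lam)
    (hlam1 : lam < 1) {n : ℕ} (hn : 1 ≤ n) : 0 ≤ closedFormCost lam p S n := by
  have hn0 : (0 : ℝ) < n := by exact_mod_cast hn
  rw [le_closedFormCost_iff hlam0 hlam1 hn0, hS.eq_sum n hn, zero_mul]
  positivity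

end Optimality

/-! ### The main theorem. -/

theorem corollary1 {Ω : Type*} [MeasurableSpace Ω] (μ : Measure Ω) [IsProbabilityMeasure μ]
    (lam : ℝ) (hlam0 : 0 < lam) (hlam1 : lam < 1)
    (X : ℕ → Ω → Bool) (hX : IsBernoulliArrivals μ X lam)
    (f : ℝ≥0 → ℝ≥0) (hf : Monotone f) (hf0 : f 0 = 0) (p : ℝ≥0) :
    -- the sums have an extension to the positive reals, and its closed-form cost has a minimizer
    -- as soon as the staleness cost reaches the update cost
    (∃ S : ℝ → ℝ, IsSumExtension f S ∧
      ((∃ a : ℝ≥0, p ≤ f a) →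
        ∃ τ' : ℝ, 0 < τ' ∧ IsMinOn (closedFormCost lam p S) (Set.Ioi 0) τ')) ∧
    ∀ S : ℝ → ℝ, IsSumExtension f S →
      -- every threshold-based policy is online, and its average cost exists and has the closed form
      (∀ n : ℕ, 1 ≤ n → IsOnline μ X (thresholdPolicy X n) ∧
        Tendsto (costPerRequest μ f p X (thresholdPolicy X n)) atTop
          (𝓝 (ENNReal.ofReal (closedFormCost lam p S n)))) ∧
      -- the better one of the two roundings of a minimizer is an optimal threshold
      ∀ τ' : ℝ, 0 < τ' → IsMinOn (closedFormCost lam p S) (Set.Ioi 0) τ' →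
        ∀ τopt : ℕ, 1 ≤ τopt → (τopt = ⌊τ'⌋₊ ∨ τopt = ⌈τ'⌉₊) →
          (∀ n : ℕ, 1 ≤ n → (n = ⌊τ'⌋₊ ∨ n = ⌈τ'⌉₊) →
            averageCost μ f p X (thresholdPolicy X τopt) ≤
              averageCost μ f p X (thresholdPolicy X n)) →
          (∀ n : ℕ, 1 ≤ n →
            averageCost μ f p X (thresholdPolicy X τopt) ≤
              averageCost μ f p X (thresholdPolicy X n)) ∧
          (∀ U : ℕ → Ω → Bool, IsOnline μ X U →
            averageCost μ f p X (thresholdPolicy X τopt) ≤ averageCost μ f p X U) := by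
  refine ⟨⟨linearInterpolation f, isSumExtension_linearInterpolation hf hf0,
    fun ⟨a, ha⟩ => exists_isMinOn_closedFormCost hf hf0 hlam0 hlam1 ha⟩, fun S hS => ?_⟩
  have hcost : ∀ n : ℕ, 1 ≤ n → lam * ∑ t ∈ Finset.Ico 1 n, (f t : ℝ) + p =
      closedFormCost lam p S n * (lam * (n - 1) + 1) := fun n hn => by
    rw [← closedFormCost_mul hlam0 hlam1 (by exact_mod_cast hn), hS.eq_sum n hn]
  have htend : ∀ n : ℕ, 1 ≤ n → Tendsto (costPerRequest μ f p X (thresholdPolicy X n)) atTop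
      (𝓝 (ENNReal.ofReal (closedFormCost lam p S n))) := fun n hn =>
    tendsto_costPerRequest_thresholdPolicy hX hlam0 hf hf0 p hn (hcost n hn)
  have havg : ∀ n : ℕ, 1 ≤ n → averageCost μ f p X (thresholdPolicy X n) =
      ENNReal.ofReal (closedFormCost lam p S n) := fun n hn => (htend n hn).liminf_eq
  refine ⟨fun n hn => ⟨isOnline_thresholdPolicy hX n, htend n hn⟩, ?_⟩
  intro τ' hτ' hmin n hn hround hbest
  obtain ⟨hup, hlow⟩ := hS.crossing hlam0 hlam1 hτ' hmin hn hround fun m hm hmr => by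
    have := hbest m hm hmr
    rwa [havg n hn, havg m hm,
      ENNReal.ofReal_le_ofReal_iff (hS.closedFormCost_nonneg hlam0 hlam1 hm)] at this
  -- Threshold policies are online, so this also gives optimality among them.
  have honline : ∀ U : ℕ → Ω → Bool, IsOnline μ X U →
      averageCost μ f p X (thresholdPolicy X n) ≤ averageCost μ f p X U := fun U hU => by
    rw [havg n hn]
    refine ofReal_le_averageCost hX hlam0 hU hf p hn (hS.closedFormCost_nonneg hlam0 hlam1 hn)
      (hcost n hn) (fun a ha han => le_trans ?_ (hlow (by omega))) hup
    exact_mod_cast hf (by exact_mod_cast (by omega : a ≤ n - 1))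
  exact ⟨fun m _ => honline _ (isOnline_thresholdPolicy hX m), honline⟩
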